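/- Let $N\ge 1$ be an integer. There exist constants $c_1,c_2>0$ depending only on $N$ such that the following holds. Let $\phi:(0,+\infty)\to(0,1]$ be a non-increasing function and let $\boldsymbol{\alpha}\in\mathbb{R}^N$ be a $\phi$-badly approximable vector, i.e. $$|\boldsymbol{q}|_\infty^N\,\|\boldsymbol{\alpha}\cdot\boldsymbol{q}\|\ \ge\ \phi(|\boldsymbol{q}|_\infty)\qquad\text{for all }\boldsymbol{q}\in\mathbb{Z}^N\setminus\{\boldsymbol{0}\},$$ where $|\cdot|_\infty$ is the maximum norm, $\boldsymbol{\alpha}\cdot\boldsymbol{q}=\sum_{i=1}^N\alpha_iq_i$, and $\|x\|$ denotes the distance from the real number $x$ to the nearest integer. Then, for all real $Q\ge 1$, $$Q^N\log\bigl(Q\phi(Q)\bigr)\ \le\ c_1\sum_{\boldsymbol{q}\in[-Q,Q]^N\cap\mathbb{Z}^N\setminus\{\boldsymbol{0}\}}\|\boldsymbol{\alpha}\cdot\boldsymbol{q}\|^{-1}$$ and $$\sum_{\boldsymbol{q}\in[-Q,Q]^N\cap\mathbb{Z}^N\setminus\{\boldsymbol{0}\}}\|\boldsymbol{\alpha}\cdot\boldsymbol{q}\|^{-1}\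 \le\ c_2\left(Q^N\log Q+\frac{Q^N}{\phi(Q)}\right).$$ -/

import Mathlib

/-- The distance of a real number `x` to the nearest integer, usually written `‖x‖`. -/
noncomputable def distNearestInt (x : ℝ) : ℝ := |x - round x|

/-- The defining property: the distance to the nearest integer is attained and is minimal. -/
theorem distNearestInt_isLeast (x : ℝ) :
    IsLeast (Set.range fun p : ℤ => |x - p|) (distNearestInt x) := by
  refine ⟨⟨round x, rfl⟩, ?_⟩
  rintro _ ⟨p, rfl⟩
  exact round_le x p

/-- The inner product `α · q` of a real vector and an integer vector. -/
def dotInt {N : ℕ} (α : Fin N → ℝ) (q : Fin N → ℤ) : ℝ := ∑ i, α i * (q i : ℝ)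

/-- `α` is `φ`-badly approximable: `|q|_∞ ^ N * ‖α · q‖ ≥ φ(|q|_∞)` for all nonzero integer
vectors `q`. The norm on `Fin N → ℤ` is the maximum norm. -/
def IsBadlyApproximable {N : ℕ} (φ : ℝ → ℝ) (α : Fin N → ℝ) : Prop :=
  ∀ q : Fin N → ℤ, q ≠ 0 → φ ‖q‖ ≤ ‖q‖ ^ N * distNearestInt (dotInt α q)

/-- The finite set `[-Q, Q] ^ N ∩ ℤ ^ N ∖ {0}`. -/
noncomputable def boxPoints (N : ℕ) (Q : ℝ) : Finset (Fin N → ℤ) :=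
  (Fintype.piFinset fun _ => Finset.Icc ⌈-Q⌉ ⌊Q⌋).erase 0

theorem mem_boxPoints {N : ℕ} {Q : ℝ} {q : Fin N → ℤ} :
    q ∈ boxPoints N Q ↔ q ≠ 0 ∧ ∀ i, (q i : ℝ) ∈ Set.Icc (-Q) Q := by
  simp only [boxPoints, Finset.mem_erase, Fintype.mem_piFinset, Finset.mem_Icc, Int.ceil_le,
    Int.le_floor, Set.mem_Icc]

/-- The sum of `‖α · q‖⁻¹` over `q ∈ [-Q, Q] ^ N ∩ ℤ ^ N ∖ {0}`. -/
noncomputable def reciprocalSum {N : ℕ} (α : Fin N → ℝ) (Q : ℝ) : ℝ :=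
  ∑ q ∈ boxPoints N Q, (distNearestInt (dotInt α q))⁻¹

/-! ### Counting points in a cube -/

/-! Upper bound: count the box points with `‖α · q‖ ≤ ε` through the points `((α · q + p) / ε, q /
Q)` of a lattice in dimension `N + 1`, all in the unit cube. If they span, the lattice is coarsely
dense, and translating them along the circle bounds their number by `O(ε Q ^ N)`. Otherwise they lie
in a hyperplane, where bad approximability keeps them `1 / L` apart, so there are `O(L ^ N)`. Hence
`card_filter_distNearestInt_le`. Take `ε = δ b ^ (j + 1)`, with `δ = φ(Q) / Q ^ N` the least
possible value. Divided by the layer height, the first count gives `O(Q ^ N)` in each of `O(log (1 /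
δ))` layers; the second gives a geometric series of total `O(1 / δ)`.

Lower bound: Dirichlet's pigeonhole yields about `Q ^ N / 2 ^ j` points with `‖α · q‖ ≤ 2 ^ (-j)`;
each of about `log Q` dyadic levels therefore contributes order `Q ^ N`. -/

theorem card_le_of_separated_in_cube {ι β : Type*} [Fintype ι] [DecidableEq ι] (x : β → ι → ℝ)
    (s : Finset β) (L : ℕ) (hbound : ∀ b ∈ s, ∀ i, |x b i| ≤ 1)
    (hsep : ∀ b ∈ s, ∀ b' ∈ s, b ≠ b' → ∃ i, 1 ≤ L * |x b i - x b' i|) :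
    s.card ≤ (2 * L + 1) ^ Fintype.card ι := by
  have hcard : (Fintype.piFinset fun _ : ι => Finset.Icc (-(L : ℤ)) L).card =
      (2 * L + 1) ^ Fintype.card ι := by
    rw [Fintype.card_piFinset]
    simp only [Int.card_Icc, Finset.prod_const, Finset.card_univ]
    congr 1
    omega
  rw [← hcard]
  refine Finset.card_le_card_of_injOn (fun b i => ⌊(L : ℝ) * x b i⌋) ?_ ?_
  · intro b hb
    simp only [Finset.mem_coe, Fintype.mem_piFinset, Finset.mem_Icc]
    intro i
    have h := abs_le.1 (hbound b hb i)
    have hL : (0 : ℝ) ≤ L := Nat.cast_nonneg L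
    constructor
    · rw [Int.le_floor]
      push_cast
      nlinarith [h.1]
    · have : ((⌊(L : ℝ) * x b i⌋ : ℤ) : ℝ) ≤ ((L : ℤ) : ℝ) := by
        refine (Int.floor_le _).trans ?_
        push_cast
        nlinarith [h.2]
      exact_mod_cast this
  · intro b hb b' hb' heq
    by_contra hne
    obtain ⟨i, hi⟩ := hsep b hb b' hb' hne
    have h := Int.abs_sub_lt_one_of_floor_eq_floor (congrFun heq i)
    rw [← mul_sub, abs_mul, Nat.abs_cast] at h
    linarith

/-- If a linear functional vanishes at `x`, some coordinate is controlled by the others,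
uniformly in `x`. -/
theorem exists_coord_abs_le_sum {ι : Type*} [Fintype ι] [DecidableEq ι]
    (f : (ι → ℝ) →ₗ[ℝ] ℝ) (hf : f ≠ 0) :
    ∃ i₀, ∀ x, f x = 0 → |x i₀| ≤ ∑ i : {i // i ≠ i₀}, |x i| := by
  have hexp : ∀ x, f x = ∑ i, x i * f (Pi.single i 1) := fun x => by
    conv_lhs => rw [pi_eq_sum_univ' x, map_sum]
    refine Finset.sum_congr rfl fun i _ => ?_
    rw [map_smul, smul_eq_mul]
  have hne : Nonempty ι := by
    by_contra h
    rw [not_nonempty_iff] at h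
    exact hf (LinearMap.ext fun x => by rw [hexp]; simp)
  -- Solve `f x = 0` for the coordinate with the largest coefficient: all coefficient ratios are
  -- then at most 1.
  obtain ⟨i₀, hi₀⟩ := Finite.exists_max fun i => |f (Pi.single i 1)|
  have hpos : 0 < |f (Pi.single i₀ 1)| := by
    rw [abs_pos]
    intro h0
    refine hf (LinearMap.ext fun x => ?_)
    rw [hexp, LinearMap.zero_apply]
    refine Finset.sum_eq_zero fun i _ => ?_
    have := hi₀ i
    rw [h0, abs_zero, abs_nonpos_iff] at this
    rw [this, mul_zero]
  refine ⟨i₀, fun x hx => ?_⟩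
  rw [hexp, Fintype.sum_eq_add_sum_subtype_ne _ i₀] at hx
  refine le_of_mul_le_mul_right ?_ hpos
  rw [← abs_mul, eq_neg_of_add_eq_zero_left hx, abs_neg, Finset.sum_mul]
  refine (Finset.abs_sum_le_sum_abs _ _).trans (Finset.sum_le_sum fun i _ => ?_)
  rw [abs_mul]
  exact mul_le_mul_of_nonneg_left (hi₀ _) (abs_nonneg _)

theorem card_le_of_separated_in_hyperplane {ι β : Type*} [Fintype ι] [DecidableEq ι]
    (x : β → ι → ℝ) (s : Finset β) (n L : ℕ) (hn : 1 ≤ n) (hι : Fintype.card ι = n + 1)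
    (hbound : ∀ b ∈ s, ∀ i, |x b i| ≤ 1)
    (hsep : ∀ b ∈ s, ∀ b' ∈ s, b ≠ b' → ∃ i, 1 ≤ L * |x b i - x b' i|)
    (f : (ι → ℝ) →ₗ[ℝ] ℝ) (hf : f ≠ 0) (hfx : ∀ b ∈ s, f (x b) = 0) :
    s.card ≤ (2 * (n * L) + 1) ^ n := by
  obtain ⟨i₀, hi₀⟩ := exists_coord_abs_le_sum f hf
  have hcard : Fintype.card {i // i ≠ i₀} = n := by
    rw [Fintype.card_subtype_compl, Fintype.card_subtype_eq, hι, Nat.add_sub_cancel]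
  have hn' : (1 : ℝ) ≤ n := by exact_mod_cast hn
  rw [← hcard]
  nth_rewrite 1 [hcard]
  refine card_le_of_separated_in_cube (fun b (i : {i // i ≠ i₀}) => x b i) s (n * L)
    (fun b hb i => hbound b hb i) fun b hb b' hb' hne => ?_
  obtain ⟨i, hi⟩ := hsep b hb b' hb' hne
  push_cast
  by_cases hii : i = i₀
  -- Separation seen only in the dropped coordinate is shared among the `n` others, one of which
  -- carries at least `1 / n` of it; hence the resolution `n * L`.
  · subst hii
    have hle := hi₀ (x b - x b') (by rw [map_sub, hfx b hb, hfx b' hb', sub_zero])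
    by_contra! hlt
    have hsum : ∑ j : {j // j ≠ i}, (n * L * |x b j - x b' j|) < ∑ j : {j // j ≠ i}, (1 : ℝ) := by
      refine Finset.sum_lt_sum_of_nonempty ?_ fun j _ => hlt j
      rw [← Finset.card_pos, Finset.card_univ, hcard]
      omega
    rw [← Finset.mul_sum, Finset.sum_const, Finset.card_univ, hcard, nsmul_one] at hsum
    simp only [Pi.sub_apply] at hle
    have hL : (0 : ℝ) ≤ L := Nat.cast_nonneg L
    have h1 : 1 ≤ L * ∑ j : {j // j ≠ i}, |x b j - x b' j| :=
      hi.trans (mul_le_mul_of_nonneg_left hle hL)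
    nlinarith
  · refine ⟨⟨i, hii⟩, ?_⟩
    have h0 : 0 ≤ L * |x b i - x b' i| := by positivity
    nlinarith

/-- A subgroup containing a spanning set of vectors in the unit cube is coarsely dense. -/
theorem exists_mem_addSubgroup_near {ι : Type*} [Fintype ι] (Λ : AddSubgroup (ι → ℝ))
    (S : Set (ι → ℝ)) (hSΛ : S ⊆ Λ) (hS : ∀ x ∈ S, ∀ i, |x i| ≤ 1)
    (hspan : Submodule.span ℝ S = ⊤) (v : ι → ℝ) :
    ∃ g ∈ Λ, ∀ i, |v i - g i| ≤ Fintype.card ι := by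
  obtain ⟨b, hbS, hbspan, hbli⟩ := exists_linearIndependent ℝ S
  let B := Module.Basis.mk hbli (by rw [Subtype.range_coe, hbspan, hspan])
  have : Fintype b := FiniteDimensional.fintypeBasisIndex B
  have hcard : Fintype.card b = Fintype.card ι := by
    rw [← Module.finrank_eq_card_basis B, Module.finrank_fintype_fun_eq_card]
  have hB : ∀ k, B k = k.1 := fun k => by simp [B]
  -- Rounding down coordinates in a basis drawn from `S` leaves an error with coefficients in `[0,
  -- 1)`.
  refine ⟨∑ k, ⌊B.repr v k⌋ • k.1, ?_, fun i => ?_⟩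
  · exact sum_mem fun k _ => zsmul_mem (hSΛ (hbS k.2)) _
  · have hv : v i = ∑ k, B.repr v k * k.1 i := by
      conv_lhs => rw [← B.sum_repr v]
      simp [hB]
    have hdiff : v i - (∑ k : b, ⌊B.repr v k⌋ • k.1) i = ∑ k, Int.fract (B.repr v k) * k.1 i := by
      rw [hv, Finset.sum_apply, ← Finset.sum_sub_distrib]
      refine Finset.sum_congr rfl fun k _ => ?_
      simp only [Pi.smul_apply, zsmul_eq_mul, Int.fract]
      ring
    rw [hdiff, ← hcard]
    refine (Finset.abs_sum_le_sum_abs _ _).trans ?_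
    refine (Finset.sum_le_card_nsmul _ _ 1 fun k _ => ?_).trans (by simp)
    rw [abs_mul, Int.abs_fract]
    exact mul_le_one₀ (Int.fract_lt_one _).le (abs_nonneg _) (hS _ (hbS k.2) i)

/-! ### The distance to the nearest integer -/

theorem distNearestInt_nonneg (x : ℝ) : 0 ≤ distNearestInt x := abs_nonneg _

theorem distNearestInt_le_half (x : ℝ) : distNearestInt x ≤ 1 / 2 := abs_sub_round x

theorem distNearestInt_le (x : ℝ) (p : ℤ) : distNearestInt x ≤ |x - p| := round_le x p

theorem dotInt_add {N : ℕ} (α : Fin N → ℝ) (q r : Fin N → ℤ) :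
    dotInt α (q + r) = dotInt α q + dotInt α r := by
  simp [dotInt, mul_add, Finset.sum_add_distrib]

theorem dotInt_sub {N : ℕ} (α : Fin N → ℝ) (q r : Fin N → ℤ) :
    dotInt α (q - r) = dotInt α q - dotInt α r := by
  simp [dotInt, mul_sub, Finset.sum_sub_distrib]

theorem dotInt_zero {N : ℕ} (α : Fin N → ℝ) : dotInt α 0 = 0 := by
  simp [dotInt]

theorem abs_le_of_mem_boxPoints {N : ℕ} {Q : ℝ} {q : Fin N → ℤ} (hq : q ∈ boxPoints N Q)
    (i : Fin N) : |(q i : ℝ)| ≤ Q :=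
  abs_le.2 ((mem_boxPoints.1 hq).2 i)

theorem card_int_Icc_le (a b : ℝ) (h : a ≤ b) : ((Finset.Icc ⌈a⌉ ⌊b⌋).card : ℝ) ≤ b - a + 1 := by
  rw [Int.card_Icc]
  rcases le_total (⌊b⌋ + 1 - ⌈a⌉) 0 with h0 | h0
  · rw [Int.toNat_of_nonpos h0]
    push_cast
    linarith
  · have : ((⌊b⌋ + 1 - ⌈a⌉).toNat : ℝ) = ((⌊b⌋ + 1 - ⌈a⌉ : ℤ) : ℝ) := by
      exact_mod_cast congrArg (Int.cast (R := ℝ)) (Int.toNat_of_nonneg h0)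
    rw [this]
    push_cast
    linarith [Int.floor_le b, Int.le_ceil a]

/-- Vectors `q` of a finite set, with `α · q` near an integer `p q`, are counted by translating
them so as to cover the circle evenly. -/
theorem card_mul_le_of_translates {N : ℕ} (α : Fin N → ℝ) (s : Finset (Fin N → ℤ))
    (p : (Fin N → ℤ) → ℤ) (R η : ℝ) (hR : 0 ≤ R) (hη : 0 < η)
    (h : ∀ t : ℝ, ∃ (p' : ℤ) (r : Fin N → ℤ), ∀ q ∈ s, (∀ i, |((q + r) i : ℝ)| ≤ R) ∧
      |dotInt α (q + r) + (p q + p' : ℤ) + t| ≤ η) :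
    (s.card : ℝ) ≤ 3 * η * (2 * R + 1) ^ N := by
  -- The circle is sampled at `k / H`. With `η * H ≥ 1`, an interval of length `2ηH` holds at most
  -- `3ηH` integers.
  obtain ⟨H, hH⟩ := exists_nat_ge (1 / η)
  have hHpos : (0 : ℝ) < H := lt_of_lt_of_le (by positivity) hH
  have hH0 : 0 < H := by exact_mod_cast hHpos
  have hηH : 1 ≤ η * H := by rwa [div_le_iff₀' hη] at hH
  choose P r hPr using fun k : ℕ => h (k / H)
  let D : Finset (Fin N → ℤ) := Fintype.piFinset fun _ => Finset.Icc ⌈-R⌉ ⌊R⌋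
  let W : Finset (Σ _ : Fin N → ℤ, ℤ) :=
    D.sigma fun q => Finset.Icc ⌈-(η * H) - dotInt α q * H⌉ ⌊η * H - dotInt α q * H⌋
  have hW : (W.card : ℝ) ≤ (2 * R + 1) ^ N * (3 * (η * H)) := by
    rw [Finset.card_sigma, Nat.cast_sum]
    refine (Finset.sum_le_card_nsmul _ _ (3 * (η * H)) fun q _ => ?_).trans ?_
    · refine (card_int_Icc_le _ _ (by linarith)).trans ?_
      linarith
    · rw [nsmul_eq_mul]
      refine mul_le_mul_of_nonneg_right ?_ (by positivity)
      rw [Fintype.card_piFinset, Nat.cast_prod, Finset.prod_const, Finset.card_univ,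
        Fintype.card_fin]
      refine pow_le_pow_left₀ (Nat.cast_nonneg _) ((card_int_Icc_le _ _ (by linarith)).trans ?_) N
      linarith
  have hcard : (Finset.range H ×ˢ s).card ≤ W.card := by
    -- Injective because `k` is the residue of the second component modulo `H`, and then `r k` is
    -- known.
    refine Finset.card_le_card_of_injOn
      (fun a => ⟨a.2 + r a.1, (p a.2 + P a.1) * H + a.1⟩) ?_ ?_
    · rintro ⟨k, q⟩ ha
      simp only [Finset.coe_product, Set.mem_prod, Finset.mem_coe] at ha
      obtain ⟨hb, hd⟩ := hPr k q ha.2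
      have hd' : |dotInt α (q + r k) * H + ((p q + P k) * H + k)| ≤ η * H := by
        have : dotInt α (q + r k) * H + ((p q + P k) * H + k) =
            (dotInt α (q + r k) + (p q + P k : ℤ) + k / H) * H := by
          push_cast
          field_simp
          ring
        rw [this, abs_mul, Nat.abs_cast]
        exact mul_le_mul_of_nonneg_right hd hHpos.le
      rw [abs_le] at hd'
      simp only [W, D, Finset.mem_coe, Finset.mem_sigma, Fintype.mem_piFinset, Finset.mem_Icc,
        Int.ceil_le, Int.le_floor]
      refine ⟨fun i => abs_le.1 (hb i), ?_, ?_⟩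
      · push_cast
        linarith
      · push_cast
        linarith
    · rintro ⟨k, q⟩ ha ⟨k', q'⟩ ha' heq
      simp only [Finset.coe_product, Set.mem_prod, Finset.mem_coe, Finset.mem_range] at ha ha'
      simp only [Sigma.mk.injEq, heq_eq_eq] at heq
      have hk : k = k' := by
        have := congrArg (· % (H : ℤ)) heq.2
        simp only [Int.mul_add_emod_self_right] at this
        rw [Int.emod_eq_of_lt (by omega) (by omega), Int.emod_eq_of_lt (by omega) (by omega)] at this
        exact_mod_cast this
      subst hk
      rw [add_right_cancel heq.1]
  rw [Finset.card_product, Finset.card_range] at hcard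
  have hcard' : (H : ℝ) * s.card ≤ W.card := by exact_mod_cast hcard
  refine le_of_mul_le_mul_left ((hcard'.trans hW).trans (le_of_eq ?_)) hHpos
  ring

/-! ### Counting small values of a linear form -/

/-- The point `((α · q + p) / ε, q / Q)` for the integer `p` closest to `-α · q`. -/
noncomputable def scaledPoint {N : ℕ} (α : Fin N → ℝ) (Q ε : ℝ) (q : Fin N → ℤ) :
    Option (Fin N) → ℝ :=
  fun o => o.elim ((dotInt α q - round (dotInt α q)) / ε) fun i => q i / Q

/-- The lattice of all points `((α · q + p) / ε, q / Q)`. -/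
noncomputable def scaledLattice {N : ℕ} (α : Fin N → ℝ) (Q ε : ℝ) :
    AddSubgroup (Option (Fin N) → ℝ) where
  carrier := {g | ∃ (p : ℤ) (q : Fin N → ℤ),
    g = fun o => o.elim ((dotInt α q + p) / ε) fun i => q i / Q}
  zero_mem' := ⟨0, 0, by ext o; cases o <;> simp [dotInt_zero]⟩
  add_mem' := by
    rintro _ _ ⟨p, q, rfl⟩ ⟨p', q', rfl⟩
    refine ⟨p + p', q + q', ?_⟩
    ext o
    cases o
    · simp [dotInt_add]
      ring
    · simp [add_div]
  neg_mem' := by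
    rintro _ ⟨p, q, rfl⟩
    refine ⟨-p, -q, ?_⟩
    ext o
    cases o
    · simp [dotInt]
      ring
    · simp [neg_div]

theorem abs_scaledPoint_le_one {N : ℕ} {α : Fin N → ℝ} {Q ε : ℝ} (hQ : 0 < Q) (hε : 0 < ε)
    {q : Fin N → ℤ} (hq : q ∈ boxPoints N Q) (hd : distNearestInt (dotInt α q) ≤ ε)
    (o : Option (Fin N)) : |scaledPoint α Q ε q o| ≤ 1 := by
  cases o with
  | none =>
    simp only [scaledPoint, Option.elim_none]
    rw [abs_div, abs_of_pos hε, div_le_one hε]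
    exact hd
  | some i =>
    simp only [scaledPoint, Option.elim_some]
    rw [abs_div, abs_of_pos hQ, div_le_one hQ]
    exact abs_le_of_mem_boxPoints hq i

theorem card_le_of_span_scaledPoint_eq_top {N : ℕ} {α : Fin N → ℝ} {Q ε : ℝ} (hQ : 1 ≤ Q)
    (hε : 0 < ε) (s : Finset (Fin N → ℤ)) (hs : ∀ q ∈ s, q ∈ boxPoints N Q)
    (hd : ∀ q ∈ s, distNearestInt (dotInt α q) ≤ ε)
    (hspan : Submodule.span ℝ (scaledPoint α Q ε '' s) = ⊤) :
    (s.card : ℝ) ≤ 3 * (N + 2) * (2 * N + 5) ^ N * (ε * Q ^ N) := by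
  have hQ0 : 0 < Q := by linarith
  -- In scaled coordinates, `N + 2` is 1 for the point itself plus `N + 1` for the lattice
  -- approximation error.
  have hmain := card_mul_le_of_translates α s (fun q => -round (dotInt α q)) ((N + 2) * Q)
    ((N + 2) * ε) (by positivity) (by positivity) fun t => by
      obtain ⟨_, ⟨p', r, rfl⟩, hg⟩ := exists_mem_addSubgroup_near (scaledLattice α Q ε)
        (scaledPoint α Q ε '' s)
        (by
          rintro _ ⟨q, -, rfl⟩
          exact ⟨-round (dotInt α q), q, by
            ext o; cases o <;> simp [scaledPoint, sub_eq_add_neg]⟩)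
        (by
          rintro _ ⟨q, hq, rfl⟩ o
          exact abs_scaledPoint_le_one hQ0 hε (hs q hq) (hd q hq) o)
        hspan (fun o => o.elim (-t / ε) fun _ => 0)
      rw [Fintype.card_option, Fintype.card_fin] at hg
      push_cast at hg
      refine ⟨p', r, fun q hq => ⟨fun i => ?_, ?_⟩⟩
      · have h1 := hg (some i)
        simp only [Option.elim_some] at h1
        rw [zero_sub, abs_neg, abs_div, abs_of_pos hQ0, div_le_iff₀ hQ0] at h1
        have h2 := abs_le_of_mem_boxPoints (hs q hq) i
        rw [Pi.add_apply, Int.cast_add]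
        refine (abs_add_le _ _).trans ?_
        linarith
      · have h1 := hg none
        simp only [Option.elim_none] at h1
        rw [← sub_div, abs_div, abs_of_pos hε, div_le_iff₀ hε, abs_sub_comm] at h1
        have h2 : |dotInt α q - round (dotInt α q)| ≤ ε := hd q hq
        have h3 : dotInt α (q + r) + ((-round (dotInt α q) + p' : ℤ) : ℝ) + t =
            (dotInt α q - round (dotInt α q)) + (dotInt α r + p' - -t) := by
          rw [dotInt_add]
          push_cast
          ring
        rw [h3]
        refine (abs_add_le _ _).trans ?_
        linarith
  refine hmain.trans ?_
  have hpow : (2 * ((N + 2) * Q) + 1) ^ N ≤ (2 * (N : ℝ) + 5) ^ N * Q ^ N := by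
    rw [← mul_pow]
    exact pow_le_pow_left₀ (by positivity) (by linarith) N
  calc 3 * ((N + 2) * ε) * (2 * ((N + 2) * Q) + 1) ^ N
      ≤ 3 * ((N + 2) * ε) * ((2 * (N : ℝ) + 5) ^ N * Q ^ N) := by gcongr
    _ = _ := by ring

theorem apply_le_apply_norm {N : ℕ} {φ : ℝ → ℝ} (hanti : AntitoneOn φ (Set.Ioi 0)) {Q : ℝ}
    {q : Fin N → ℤ} (hq : q ≠ 0) (hle : ‖q‖ ≤ Q) : φ Q ≤ φ ‖q‖ :=
  hanti (norm_pos_iff.2 hq) ((norm_pos_iff.2 hq).trans_le hle) hle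

theorem norm_le_of_mem_boxPoints {N : ℕ} {Q : ℝ} (hQ : 0 ≤ Q) {q : Fin N → ℤ}
    (hq : q ∈ boxPoints N Q) : ‖q‖ ≤ Q :=
  (pi_norm_le_iff_of_nonneg hQ).2 fun i => by
    rw [Int.norm_eq_abs]
    exact abs_le_of_mem_boxPoints hq i

theorem le_distNearestInt_of_mem_boxPoints {N : ℕ} {φ : ℝ → ℝ} {α : Fin N → ℝ}
    (hanti : AntitoneOn φ (Set.Ioi 0)) (hα : IsBadlyApproximable φ α) {Q : ℝ} (hQ : 1 ≤ Q)
    {q : Fin N → ℤ} (hq : q ∈ boxPoints N Q) :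
    φ Q / Q ^ N ≤ distNearestInt (dotInt α q) := by
  have hle := norm_le_of_mem_boxPoints (by linarith) hq
  have hne := (mem_boxPoints.1 hq).1
  rw [div_le_iff₀' (by positivity)]
  refine (apply_le_apply_norm hanti hne hle).trans ((hα q hne).trans ?_)
  exact mul_le_mul_of_nonneg_right (pow_le_pow_left₀ (norm_nonneg _) hle N)
    (distNearestInt_nonneg _)

/-- Two closer points would give `q - q'` of norm at most `Q / L` and distance below `ε / L`, with
product below `φ Q` by the choice of `L`, against bad approximability. -/
theorem scaledPoint_separated {N : ℕ} {φ : ℝ → ℝ} {α : Fin N → ℝ}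
    (hanti : AntitoneOn φ (Set.Ioi 0)) (hα : IsBadlyApproximable φ α) {Q ε : ℝ} (hQ : 1 ≤ Q)
    (hε : 0 < ε) {L : ℕ} (hL : 1 ≤ L) (hεL : ε * Q ^ N = φ Q * (L : ℝ) ^ (N + 1))
    {q q' : Fin N → ℤ} (hne : q ≠ q') :
    ∃ o, 1 ≤ L * |scaledPoint α Q ε q o - scaledPoint α Q ε q' o| := by
  by_contra! hlt
  have hQ0 : 0 < Q := by linarith
  have hL1 : (1 : ℝ) ≤ L := by exact_mod_cast hL
  have hL0 : (0 : ℝ) < L := by linarith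
  have hne' : q - q' ≠ 0 := sub_ne_zero.2 hne
  have hnorm : ‖q - q'‖ ≤ Q / L := by
    refine (pi_norm_le_iff_of_nonneg (by positivity)).2 fun i => ?_
    have h := hlt (some i)
    simp only [scaledPoint, Option.elim_some] at h
    rw [← sub_div, abs_div, abs_of_pos hQ0, mul_div_assoc', div_lt_one hQ0] at h
    rw [Int.norm_eq_abs, le_div_iff₀' hL0, Pi.sub_apply, Int.cast_sub]
    exact h.le
  have hdist : distNearestInt (dotInt α (q - q')) < ε / L := by
    have h := hlt none
    simp only [scaledPoint, Option.elim_none] at h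
    rw [← sub_div, abs_div, abs_of_pos hε, mul_div_assoc', div_lt_one hε] at h
    rw [lt_div_iff₀' hL0]
    refine lt_of_le_of_lt (mul_le_mul_of_nonneg_left
      (distNearestInt_le _ (round (dotInt α q) - round (dotInt α q'))) hL0.le) ?_
    rw [dotInt_sub]
    push_cast
    rwa [sub_sub_sub_comm]
  have h1 := apply_le_apply_norm hanti hne' (hnorm.trans (div_le_self hQ0.le hL1))
  have h2 := hα _ hne'
  have h3 : ‖q - q'‖ ^ N * distNearestInt (dotInt α (q - q')) < (Q / L) ^ N * (ε / L) :=
    mul_lt_mul' (pow_le_pow_left₀ (norm_nonneg _) hnorm N) hdist (distNearestInt_nonneg _)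
      (by positivity)
  have h4 : (Q / L) ^ N * (ε / L) = φ Q := by
    rw [div_pow, div_mul_div_comm, ← pow_succ, mul_comm, hεL,
      mul_div_assoc, div_self (by positivity), mul_one]
  linarith

theorem card_filter_distNearestInt_le {N : ℕ} (hN : 1 ≤ N) {φ : ℝ → ℝ} {α : Fin N → ℝ}
    (hanti : AntitoneOn φ (Set.Ioi 0)) (hα : IsBadlyApproximable φ α) {Q ε : ℝ} (hQ : 1 ≤ Q)
    (hε : 0 < ε) {L : ℕ} (hL : 1 ≤ L) (hεL : ε * Q ^ N = φ Q * (L : ℝ) ^ (N + 1)) :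
    (((boxPoints N Q).filter fun q => distNearestInt (dotInt α q) ≤ ε).card : ℝ) ≤
      3 * (N + 2) * (2 * N + 5) ^ N * (ε * Q ^ N + (L : ℝ) ^ N) := by
  set s := (boxPoints N Q).filter fun q => distNearestInt (dotInt α q) ≤ ε
  have hs : ∀ q ∈ s, q ∈ boxPoints N Q := fun q hq => (Finset.mem_filter.1 hq).1
  have hd : ∀ q ∈ s, distNearestInt (dotInt α q) ≤ ε := fun q hq => (Finset.mem_filter.1 hq).2
  have hQ0 : 0 < Q := by linarith
  by_cases hspan : Submodule.span ℝ (scaledPoint α Q ε '' s) = ⊤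
  · refine (card_le_of_span_scaledPoint_eq_top hQ hε s hs hd hspan).trans ?_
    gcongr
    exact le_add_of_nonneg_right (by positivity)
  · obtain ⟨f, hf, hfle⟩ := Submodule.exists_le_ker_of_lt_top _ (lt_top_iff_ne_top.2 hspan)
    have hcard := card_le_of_separated_in_hyperplane (scaledPoint α Q ε) s N L hN (by simp)
      (fun q hq => abs_scaledPoint_le_one hQ0 hε (hs q hq) (hd q hq))
      (fun q _ q' _ hne => scaledPoint_separated hanti hα hQ hε hL hεL hne) f hf
      (fun q hq => hfle (Submodule.subset_span ⟨q, hq, rfl⟩))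
    have hL1 : (1 : ℝ) ≤ L := by exact_mod_cast hL
    have hN0 : (0 : ℝ) ≤ N := Nat.cast_nonneg N
    calc (s.card : ℝ) ≤ (2 * (N * L) + 1) ^ N := by exact_mod_cast hcard
      _ ≤ ((2 * N + 5) * L) ^ N := pow_le_pow_left₀ (by positivity) (by nlinarith) N
      _ = 1 * (2 * N + 5) ^ N * (0 + (L : ℝ) ^ N) := by rw [mul_pow]; ring
      _ ≤ _ := by
        gcongr
        · linarith
        · positivity

/-! ### The upper bound -/

theorem sum_inv_le_sum_card_div {ι : Type*} (s : Finset ι) (d : ι → ℝ) (δ b : ℝ) (J : ℕ)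
    (hδ : 0 < δ) (hb : 1 < b) (hd : ∀ q ∈ s, δ ≤ d q ∧ d q < δ * b ^ J) :
    ∑ q ∈ s, (d q)⁻¹ ≤
      ∑ j ∈ Finset.range J, ((s.filter fun q => d q ≤ δ * b ^ (j + 1)).card : ℝ) / (δ * b ^ j) := by
  have hb0 : 0 < b := by linarith
  calc ∑ q ∈ s, (d q)⁻¹
      ≤ ∑ q ∈ s, ∑ j ∈ Finset.range J, if d q ≤ δ * b ^ (j + 1) then 1 / (δ * b ^ j) else 0 := by
        refine Finset.sum_le_sum fun q hq => ?_
        obtain ⟨h1, h2⟩ := hd q hq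
        obtain ⟨j, hj1, hj2⟩ := exists_nat_pow_near ((one_le_div hδ).2 h1) hb
        rw [le_div_iff₀' hδ] at hj1
        rw [div_lt_iff₀' hδ] at hj2
        have hjJ : j < J := by
          by_contra! hJj
          have : δ * b ^ J ≤ δ * b ^ j := by gcongr; exact hb.le
          linarith
        refine le_trans ?_ (Finset.single_le_sum (fun i _ => ?_) (Finset.mem_range.2 hjJ))
        · rw [if_pos hj2.le, one_div]
          gcongr
        · split_ifs <;> positivity
    _ = _ := by
        rw [Finset.sum_comm]
        refine Finset.sum_congr rfl fun j _ => ?_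
        rw [← Finset.sum_filter, Finset.sum_const, nsmul_eq_mul, mul_one_div]

theorem reciprocalSum_le {N : ℕ} (hN : 1 ≤ N) {φ : ℝ → ℝ} {α : Fin N → ℝ}
    (hφ : Set.MapsTo φ (Set.Ioi 0) (Set.Ioc 0 1)) (hanti : AntitoneOn φ (Set.Ioi 0))
    (hα : IsBadlyApproximable φ α) {Q : ℝ} (hQ : 1 ≤ Q) :
    reciprocalSum α Q ≤ 3 * (N + 2) * (2 * N + 5) ^ N * 2 ^ (N + 1) * (N + 3) *
      (Q ^ N * Real.log Q + Q ^ N / φ Q) := by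
  have hQ0 : 0 < Q := by linarith
  obtain ⟨hφ0, hφ1⟩ := hφ (show Q ∈ Set.Ioi 0 from hQ0)
  have hQN : 1 ≤ Q ^ N := one_le_pow₀ hQ
  set C : ℝ := 3 * (N + 2) * (2 * N + 5) ^ N with hC
  have hC0 : 0 < C := by positivity
  set δ := φ Q / Q ^ N with hδdef
  have hδ : 0 < δ := by positivity
  have hδ1 : δ ≤ 1 := (div_le_one (by positivity)).2 (hφ1.trans hQN)
  -- This ratio makes `L = 2 ^ (j + 1)` an exact integer solution of the relation between `ε` and
  -- `L`.
  set b : ℝ := 2 ^ (N + 1) with hbdef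
  have hb : 1 < b := one_lt_pow₀ (by norm_num) (by omega)
  obtain ⟨J, hJ1, hJ2⟩ := exists_nat_pow_near ((one_le_div hδ).2 hδ1) hb
  rw [div_lt_iff₀' hδ] at hJ2
  have hJlog : (J : ℝ) ≤ N * Real.log Q + 1 / φ Q := by
    have h1 : J * ((N + 1) * Real.log 2) ≤ Real.log (1 / δ) := by
      have := Real.log_le_log (by positivity) hJ1
      rwa [hbdef, Real.log_pow, Real.log_pow, Nat.cast_add_one] at this
    have h2 : 1 ≤ (N + 1) * Real.log 2 := by
      have : (1 : ℝ) ≤ N := by exact_mod_cast hN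
      nlinarith [Real.log_two_gt_d9]
    have h3 : Real.log (1 / δ) = N * Real.log Q + Real.log (1 / φ Q) := by
      rw [hδdef, one_div_div, div_eq_mul_one_div, Real.log_mul (by positivity) (by positivity),
        Real.log_pow]
    have h4 : Real.log (1 / φ Q) ≤ 1 / φ Q := Real.log_le_self (by positivity)
    have h5 : (J : ℝ) ≤ J * ((N + 1) * Real.log 2) :=
      le_mul_of_one_le_right (Nat.cast_nonneg J) h2
    linarith
  have hdyadic := sum_inv_le_sum_card_div (boxPoints N Q) (fun q => distNearestInt (dotInt α q))
    δ b (J + 1) hδ hb fun q hq => ⟨le_distNearestInt_of_mem_boxPoints hanti hα hQ hq, by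
      linarith [distNearestInt_le_half (dotInt α q)]⟩
  have hterm : ∀ j ∈ Finset.range (J + 1),
      (((boxPoints N Q).filter fun q => distNearestInt (dotInt α q) ≤ δ * b ^ (j + 1)).card : ℝ) /
        (δ * b ^ j) ≤ C * b * Q ^ N + C * 2 ^ N / δ * (1 / 2) ^ j := fun j _ => by
    have hL : (1 : ℕ) ≤ 2 ^ (j + 1) := Nat.one_le_two_pow
    have hcount := card_filter_distNearestInt_le hN hanti hα hQ
      (ε := δ * b ^ (j + 1)) (by positivity) hL (by
        rw [hδdef, hbdef]
        push_cast
        rw [← pow_mul, ← pow_mul, mul_comm (N + 1)]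
        field_simp)
    rw [div_le_iff₀ (by positivity)]
    refine hcount.trans (le_of_eq ?_)
    have h2 : ((1 / 2 : ℝ)) ^ j * b ^ j = 2 ^ (j * N) := by
      rw [← mul_pow, hbdef, pow_succ]
      rw [mul_comm j N, pow_mul]
      congr 1
      ring
    have h3 : ((2 ^ (j + 1) : ℕ) : ℝ) ^ N = 2 ^ N * ((1 / 2 : ℝ) ^ j * b ^ j) := by
      rw [h2]
      push_cast
      ring
    rw [h3]
    field_simp
    ring
  have hsum : reciprocalSum α Q ≤ C * b * ((J + 1) * Q ^ N + 1 / δ) := by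
    refine (hdyadic.trans (Finset.sum_le_sum hterm)).trans ?_
    rw [Finset.sum_add_distrib, ← Finset.mul_sum, Finset.sum_const, Finset.card_range,
      nsmul_eq_mul, Nat.cast_add_one, ← Finset.mul_sum]
    have := mul_le_mul_of_nonneg_left (sum_geometric_two_le (J + 1))
      (show 0 ≤ C * 2 ^ N / δ by positivity)
    refine (add_le_add_right this _).trans (le_of_eq ?_)
    rw [hbdef]
    ring
  refine hsum.trans ?_
  rw [mul_assoc (C * b)]
  refine mul_le_mul_of_nonneg_left ?_ (by positivity)
  have hlog : 0 ≤ Real.log Q := Real.log_nonneg hQ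
  have hδinv : 1 / δ = Q ^ N / φ Q := by rw [hδdef, one_div_div]
  have h1 : (J + 1) * Q ^ N ≤ (N * Real.log Q + 1 / φ Q + 1) * Q ^ N := by gcongr
  have h2 : Q ^ N ≤ Q ^ N / φ Q := le_div_self (by positivity) hφ0 hφ1
  have h3 : (N * Real.log Q + 1 / φ Q + 1) * Q ^ N =
      N * (Q ^ N * Real.log Q) + Q ^ N / φ Q + Q ^ N := by ring
  have h4 : 0 ≤ Q ^ N * Real.log Q := by positivity
  have h5 : 0 ≤ N * (Q ^ N / φ Q) := by positivity
  rw [hδinv]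
  nlinarith

/-! ### The lower bound -/

/-- Pigeonhole on fractional parts in `M` equal arcs, then differences with a fixed member `q₀` of a
full arc; the `+ 1` accounts for `q₀` itself. -/
theorem div_le_card_filter_distNearestInt {N : ℕ} (α : Fin N → ℝ) {Q : ℝ} (hQ : 1 ≤ Q) {M : ℕ}
    (hM : 1 ≤ M) :
    Q ^ N / M ≤ (((boxPoints N Q).filter fun q => distNearestInt (dotInt α q) * M ≤ 1).card : ℝ)
      + 1 := by
  have hM0 : (0 : ℝ) < M := by exact_mod_cast hM
  let P : Finset (Fin N → ℤ) := Fintype.piFinset fun _ => Finset.Icc 0 ⌊Q⌋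
  have hP : Q ^ N ≤ (P.card : ℝ) := by
    rw [Fintype.card_piFinset, Nat.cast_prod, Finset.prod_const, Finset.card_univ,
      Fintype.card_fin]
    refine pow_le_pow_left₀ (by linarith) ?_ N
    rw [Int.card_Icc, sub_zero]
    have h0 : 0 ≤ ⌊Q⌋ + 1 := by have := Int.floor_nonneg.2 (show 0 ≤ Q by linarith); omega
    have : ((⌊Q⌋ + 1).toNat : ℝ) = ((⌊Q⌋ + 1 : ℤ) : ℝ) := by
      exact_mod_cast congrArg (Int.cast (R := ℝ)) (Int.toNat_of_nonneg h0)
    rw [this]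
    push_cast
    exact (Int.lt_floor_add_one Q).le
  obtain ⟨y, -, hy⟩ := Finset.exists_le_card_fiber_of_nsmul_le_card_of_maps_to
    (s := P) (t := Finset.Ico (0 : ℤ) M) (f := fun q => ⌊(M : ℝ) * Int.fract (dotInt α q)⌋)
    (b := Q ^ N / M)
    (fun q _ => by
      have h1 := Int.fract_nonneg (dotInt α q)
      have h2 := Int.fract_lt_one (dotInt α q)
      rw [Finset.mem_Ico, Int.floor_lt]
      refine ⟨Int.floor_nonneg.2 (by positivity), ?_⟩
      push_cast
      nlinarith)
    ⟨0, by simp; omega⟩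
    (by
      rw [Int.card_Ico, nsmul_eq_mul, sub_zero, Int.toNat_natCast, mul_div_cancel₀ _ hM0.ne']
      exact hP)
  set F := P.filter fun q => ⌊(M : ℝ) * Int.fract (dotInt α q)⌋ = y
  have hF : F.Nonempty := by
    rw [← Finset.card_pos]
    have : (0 : ℝ) < F.card := lt_of_lt_of_le (by positivity) hy
    exact_mod_cast this
  obtain ⟨q₀, hq₀⟩ := hF
  have hcard : (F.erase q₀).card ≤
      ((boxPoints N Q).filter fun q => distNearestInt (dotInt α q) * M ≤ 1).card := by
    refine Finset.card_le_card_of_injOn (fun q => q - q₀) (fun q hq => ?_)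
      fun q _ q' _ h => sub_left_injective h
    obtain ⟨hne, hqF⟩ := Finset.mem_erase.1 (Finset.mem_coe.1 hq)
    obtain ⟨hqP, hqy⟩ := Finset.mem_filter.1 hqF
    obtain ⟨hq₀P, hq₀y⟩ := Finset.mem_filter.1 hq₀
    rw [Finset.mem_coe, Finset.mem_filter, mem_boxPoints]
    dsimp only
    refine ⟨⟨sub_ne_zero.2 hne, fun i => ?_⟩, ?_⟩
    · have h1 := Finset.mem_Icc.1 (Fintype.mem_piFinset.1 hqP i)
      have h2 := Finset.mem_Icc.1 (Fintype.mem_piFinset.1 hq₀P i)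
      rw [Int.le_floor] at h1 h2
      have h3 : (0 : ℝ) ≤ q i := by exact_mod_cast h1.1
      have h4 : (0 : ℝ) ≤ q₀ i := by exact_mod_cast h2.1
      simp only [Pi.sub_apply, Int.cast_sub, Set.mem_Icc]
      constructor <;> linarith [h1.2, h2.2]
    · have h := Int.abs_sub_lt_one_of_floor_eq_floor (hqy.trans hq₀y.symm)
      rw [← mul_sub, abs_mul, Nat.abs_cast, mul_comm] at h
      refine le_trans (mul_le_mul_of_nonneg_right
        (distNearestInt_le _ (⌊dotInt α q⌋ - ⌊dotInt α q₀⌋)) hM0.le) (le_of_eq_of_le ?_ h.le)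
      rw [dotInt_sub]
      simp only [Int.fract]
      push_cast
      congr 2
      ring
  rw [Finset.card_erase_of_mem hq₀] at hcard
  refine hy.trans ?_
  have : F.card ≤
      ((boxPoints N Q).filter fun q => distNearestInt (dotInt α q) * M ≤ 1).card + 1 := by omega
  exact_mod_cast this

theorem sum_two_pow_le {d : ℝ} (hd : 0 < d) (n : ℕ) :
    ∑ j ∈ Finset.range n, (if d * 2 ^ j ≤ 1 then (2 : ℝ) ^ j else 0) ≤ 2 / d := by
  -- The bound `2 ^ n` strengthens the induction: it absorbs all earlier terms when the last one is
  -- present.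
  suffices h : ∑ j ∈ Finset.range n, (if d * 2 ^ j ≤ 1 then (2 : ℝ) ^ j else 0) ≤ 2 / d ∧
      ∑ j ∈ Finset.range n, (if d * 2 ^ j ≤ 1 then (2 : ℝ) ^ j else 0) ≤ 2 ^ n from h.1
  induction n with
  | zero => exact ⟨by simp; positivity, by simp⟩
  | succ n ih =>
    rw [Finset.sum_range_succ]
    have hpow : (0 : ℝ) < 2 ^ n := by positivity
    rw [pow_succ]
    split_ifs with h
    · have h1 : 2 ^ n * 2 ≤ 2 / d := by
        rw [le_div_iff₀ hd]
        linarith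
      exact ⟨by linarith [ih.2], by linarith [ih.2]⟩
    · exact ⟨by linarith [ih.1], by linarith [ih.2]⟩

theorem pow_mul_log_le_reciprocalSum {N : ℕ} (hN : 1 ≤ N) (α : Fin N → ℝ) {Q : ℝ} (hQ : 1 ≤ Q)
    (hpos : ∀ q ∈ boxPoints N Q, 0 < distNearestInt (dotInt α q)) :
    Q ^ N * Real.log Q ≤ 8 * reciprocalSum α Q := by
  have hQ0 : 0 < Q := by linarith
  have hQN : 1 ≤ Q ^ N := one_le_pow₀ hQ
  obtain ⟨n, hn1, hn2⟩ := exists_nat_pow_near hQN (one_lt_two (α := ℝ))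
  have hlog : Real.log Q ≤ n + 1 := by
    have h1 : Real.log (Q ^ N) ≤ (n + 1) * Real.log 2 := by
      have := Real.log_le_log (by positivity) hn2.le
      rwa [Real.log_pow 2, Nat.cast_add_one] at this
    rw [Real.log_pow] at h1
    have h2 : Real.log Q ≤ N * Real.log Q :=
      le_mul_of_one_le_left (Real.log_nonneg hQ) (by exact_mod_cast hN)
    have h3 : (n + 1) * Real.log 2 ≤ (n + 1) * 1 := by
      gcongr
      linarith [Real.log_two_lt_d9]
    linarith
  have hcard : Q ^ N ≤ 2 * ((boxPoints N Q).card : ℝ) := by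
    have h0 : (0 : Fin N → ℤ) ∈ Fintype.piFinset fun _ : Fin N => Finset.Icc ⌈-Q⌉ ⌊Q⌋ := by
      simp only [Fintype.mem_piFinset, Finset.mem_Icc, Pi.zero_apply, Int.ceil_le, Int.le_floor]
      intro
      constructor <;> push_cast <;> linarith
    have h1 : (boxPoints N Q).card + 1 = (2 * ⌊Q⌋.toNat + 1) ^ N := by
      have hf : 1 ≤ ⌊Q⌋ := Int.le_floor.2 (by exact_mod_cast hQ)
      rw [boxPoints, Finset.card_erase_add_one h0, Fintype.card_piFinset, Finset.prod_const,
        Finset.card_univ, Fintype.card_fin, Int.card_Icc, Int.ceil_neg]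
      congr 1
      omega
    have hf : 1 ≤ ⌊Q⌋.toNat := by
      have : 1 ≤ ⌊Q⌋ := Int.le_floor.2 (by exact_mod_cast hQ)
      omega
    have h3 : 2 * ⌊Q⌋.toNat + 1 ≤ (2 * ⌊Q⌋.toNat + 1) ^ N := Nat.le_self_pow (by omega) _
    have h4 : (2 * ⌊Q⌋.toNat + 1) ^ N ≤ 2 * (boxPoints N Q).card := by omega
    have h5 : Q ≤ ((2 * ⌊Q⌋.toNat + 1 : ℕ) : ℝ) := by
      have h6 : (⌊Q⌋ : ℝ) ≤ (⌊Q⌋.toNat : ℝ) := by exact_mod_cast Int.self_le_toNat ⌊Q⌋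
      have h7 := Int.lt_floor_add_one Q
      have h8 : (0 : ℝ) ≤ (⌊Q⌋.toNat : ℝ) := Nat.cast_nonneg _
      push_cast
      linarith
    refine (pow_le_pow_left₀ hQ0.le h5 N).trans ?_
    exact_mod_cast h4
  -- This trivial bound pays for the `+ 1` in `log Q ≤ n + 1`.
  have hS1 : ((boxPoints N Q).card : ℝ) ≤ reciprocalSum α Q := by
    rw [reciprocalSum, ← nsmul_one]
    refine Finset.card_nsmul_le_sum _ _ _ fun q hq => (one_le_inv₀ (hpos q hq)).2 ?_
    linarith [distNearestInt_le_half (dotInt α q)]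
  have hS2 : n * (Q ^ N / 2) ≤ 2 * reciprocalSum α Q := by
    calc n * (Q ^ N / 2)
        = ∑ j ∈ Finset.range n, Q ^ N / 2 := by simp
      _ ≤ ∑ j ∈ Finset.range n, ∑ q ∈ boxPoints N Q,
            (if distNearestInt (dotInt α q) * 2 ^ j ≤ 1 then (2 : ℝ) ^ j else 0) := by
          refine Finset.sum_le_sum fun j hj => ?_
          have h := div_le_card_filter_distNearestInt α hQ (M := 2 ^ j) Nat.one_le_two_pow
          push_cast at h
          rw [← Finset.sum_filter, Finset.sum_const, nsmul_eq_mul]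
          rw [div_le_iff₀ (by positivity)] at h
          -- Since `j < n`, the pigeonhole loss `2 ^ j` is at most `Q ^ N / 2`.
          have h2 : (2 : ℝ) ^ (j + 1) ≤ 2 ^ n :=
            pow_le_pow_right₀ one_le_two (Finset.mem_range.1 hj)
          rw [pow_succ] at h2
          linarith
      _ = ∑ q ∈ boxPoints N Q, ∑ j ∈ Finset.range n,
            (if distNearestInt (dotInt α q) * 2 ^ j ≤ 1 then (2 : ℝ) ^ j else 0) :=
          Finset.sum_comm
      _ ≤ ∑ q ∈ boxPoints N Q, 2 / distNearestInt (dotInt α q) :=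
          Finset.sum_le_sum fun q hq => sum_two_pow_le (hpos q hq) n
      _ = 2 * reciprocalSum α Q := by
          rw [reciprocalSum, Finset.mul_sum]
          simp only [div_eq_mul_inv]
  have hmul : Q ^ N * Real.log Q ≤ Q ^ N * (n + 1) :=
    mul_le_mul_of_nonneg_left hlog (by positivity)
  linarith

theorem theorem1p2 (N : ℕ) (hN : 1 ≤ N) :
    ∃ c₁ c₂ : ℝ, 0 < c₁ ∧ 0 < c₂ ∧
      ∀ φ : ℝ → ℝ, Set.MapsTo φ (Set.Ioi 0) (Set.Ioc 0 1) → AntitoneOn φ (Set.Ioi 0) →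
      ∀ α : Fin N → ℝ, IsBadlyApproximable φ α →
      ∀ Q : ℝ, 1 ≤ Q →
        Q ^ N * Real.log (Q * φ Q) ≤ c₁ * reciprocalSum α Q ∧
        reciprocalSum α Q ≤ c₂ * (Q ^ N * Real.log Q + Q ^ N / φ Q) := by
  refine ⟨8, 3 * (N + 2) * (2 * N + 5) ^ N * 2 ^ (N + 1) * (N + 3), by norm_num, by positivity,
    fun φ hφ hanti α hα Q hQ => ⟨?_, reciprocalSum_le hN hφ hanti hα hQ⟩⟩
  have hQ0 : 0 < Q := by linarith
  obtain ⟨hφ0, hφ1⟩ := hφ (show Q ∈ Set.Ioi 0 from hQ0)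
  -- As `φ Q ≤ 1`, the stronger lower bound with `log Q` suffices; `φ` otherwise only ensures
  -- nonzero distances.
  refine le_trans (mul_le_mul_of_nonneg_left (Real.log_le_log (by positivity)
    (mul_le_of_le_one_right hQ0.le hφ1)) (by positivity))
    (pow_mul_log_le_reciprocalSum hN α hQ fun q hq => ?_)
  exact lt_of_lt_of_le (by positivity) (le_distNearestInt_of_mem_boxPoints hanti hα hQ hq)
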